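/- Let $G$ be the path with $N \ge 1$ vertices $x_1, \dots, x_N$ (so $x_i \sim x_j$ if and only if $|i-j| = 1$) and let $\varepsilon \in [0,1]$. Consider the continuous-time Markov process $\eta_t : \{x_1, \dots, x_N\} \to [0,1]$ with generator $$ L g(\eta) = \sum_{x} \sum_{y \sim x} \mathbf{1}\{|\eta(y) - \eta(x)| < \varepsilon\}\,[g(\eta_{x \to y}) - g(\eta)], $$ where $\eta_{x \to y}$ is obtained from $\eta$ by assigning the value $\eta(x)$ to the vertex $y$; that is, each ordered pair $(x,y)$ of neighbours becomes active at rate $1$, independently of the others, and then $y$ adopts the opinion of $x$ provided that the two opinions differ by less than $\varepsilon$. Let $P_\varepsilon$ be the law of this process when the initial opinions $\eta_0(x_i)$, $1 \le i \le N$, are independent and uniformly distributed on $[0,1]$, and let $$ \nu_\varepsilon(G) = \lim_{t \to \infty} \operatorname{card}\{\eta_t(x_i) : 1 \le i \le N\} $$ be the limiting number of distinct opinions. Then there exist constants $c_1, c_2 > 0$ that depend neither on $N$ nor on $\varepsilon$ such that, for all $N \ge 1$ and all $\varepsilon \in [0,1]$, $$ P_\varepsilon\big(\nu_\varepsilon(G)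 < (1 - c_1 \varepsilon) N\big) \le \exp(-c_2\, \varepsilon N). $$ -/

import Mathlib

open MeasureTheory ProbabilityTheory Filter Topology

namespace OpinionDynamics

noncomputable section

instance isProbabilityMeasure_expMeasure_one : IsProbabilityMeasure (expMeasure 1) :=
  isProbabilityMeasure_expMeasure one_pos

/-- A configuration: each vertex carries an opinion in `[0, 1]`. -/
abbrev Config (V : Type*) : Type _ := V → unitInterval

/-- A realization of the randomness: the initial opinions, and for each ordered pair of neighbours
`d` and each `n` the waiting time between the `n`-th and the `(n+1)`-st ring of the clock of `d`. -/
abbrev Sample {V : Type*} (G : SimpleGraph V) : Type _ :=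
  Config V × (G.Dart × ℕ → ℝ)

/-- The initial opinions are i.i.d. uniform on `[0, 1]`; the waiting times are i.i.d. exponential
with parameter `1` (so the clocks of the ordered pairs of neighbours are independent rate `1`
Poisson processes) and independent of the initial opinions. -/
def law {V : Type*} [Fintype V] (G : SimpleGraph V) : Measure (Sample G) :=
  (Measure.pi fun _ : V => (volume : Measure unitInterval)).prod
    (Measure.infinitePi fun _ : G.Dart × ℕ => expMeasure 1)

instance isProbabilityMeasure_law {V : Type*} [Fintype V] (G : SimpleGraph V) :
    IsProbabilityMeasure (law G) := by
  unfold law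
  infer_instance

/-- The pair `d = (x, y)` becomes active: `y` adopts the opinion of `x` provided that the distance
between the two opinions is less than the confidence threshold `ε`. -/
def interact {V : Type*} [DecidableEq V] {G : SimpleGraph V} (ε : ℝ) (η : Config V) (d : G.Dart) :
    Config V :=
  if |(η d.snd : ℝ) - (η d.fst : ℝ)| < ε then Function.update η d.snd (η d.fst) else η

/-- The time of ring number `n + 1` of the clock of `d`. -/
def ringTime {V : Type*} {G : SimpleGraph V} (ω : Sample G) (d : G.Dart) (n : ℕ) : ℝ :=
  ∑ k ∈ Finset.range (n + 1), ω.2 (d, k)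

/-- The times at which some clock rings, in increasing order, preceded by time `0`. -/
def updateTime {V : Type*} {G : SimpleGraph V} (ω : Sample G) : ℕ → ℝ
  | 0 => 0
  | k + 1 => sInf {t : ℝ | updateTime ω k < t ∧ ∃ (d : G.Dart) (n : ℕ), ringTime ω d n = t}

open Classical in
/-- The configuration after the first `k` rings. Almost surely the pair whose clock rings at
`updateTime ω (k + 1)` exists (if `G` has an edge) and is unique. -/
def configAfter {V : Type*} [DecidableEq V] {G : SimpleGraph V} (ε : ℝ) (ω : Sample G) :
    ℕ → Config V
  | 0 => ω.1
  | k + 1 =>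
    if h : ∃ d : G.Dart, ∃ n : ℕ, ringTime ω d n = updateTime ω (k + 1) then
      interact ε (configAfter ε ω k) h.choose
    else configAfter ε ω k

/-- The number of rings up to and including time `t` (almost surely finite). -/
def numUpdates {V : Type*} {G : SimpleGraph V} (ω : Sample G) (t : ℝ) : ℕ :=
  Set.ncard {k : ℕ | updateTime ω (k + 1) ≤ t}

/-- The continuous-time opinion process `η_t` with confidence threshold `ε`, that is, the Markov
jump process with generator
`L g (η) = ∑ x, ∑ y ~ x, 1{|η y - η x| < ε} (g (η_{x → y}) - g η)`. -/
def opinionProcess {V : Type*} [DecidableEq V] {G : SimpleGraph V} (ε : ℝ) (t : ℝ) (ω : Sample G) :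
    Config V :=
  configAfter ε ω (numUpdates ω t)

/-- The number of distinct opinions in a configuration. -/
def numOpinions {V : Type*} (η : Config V) : ℕ := (Set.range η).ncard

/-- The limiting number of opinions, as time goes to infinity. -/
def limitNumOpinions {V : Type*} [DecidableEq V] (G : SimpleGraph V) (ε : ℝ) (ω : Sample G) : ℕ :=
  limUnder atTop fun t : ℝ => numOpinions (opinionProcess ε t ω)

lemma numOpinions_interact_le {V : Type*} [DecidableEq V] [Finite V] {G : SimpleGraph V} (ε : ℝ)
    (η : Config V) (d : G.Dart) : numOpinions (interact ε η d) ≤ numOpinions η := by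
  unfold numOpinions
  apply Set.ncard_le_ncard _ (Set.finite_range η)
  unfold interact
  split_ifs
  · rintro _ ⟨z, rfl⟩
    by_cases hz : z = d.snd
    · subst hz; simp
    · simp [Function.update_of_ne hz]
  · exact le_rfl

lemma antitone_numOpinions_configAfter {V : Type*} [DecidableEq V] [Finite V] {G : SimpleGraph V}
    (ε : ℝ) (ω : Sample G) : Antitone fun k => numOpinions (configAfter ε ω k) := by
  refine antitone_nat_of_succ_le fun k => ?_
  simp only [configAfter]
  split_ifs
  · exact numOpinions_interact_le _ _ _
  · exact le_rfl

/-- The limit that defines `limitNumOpinions` exists for every realization. -/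
theorem tendsto_numOpinions {V : Type*} [DecidableEq V] [Finite V] (G : SimpleGraph V)
    (ε : ℝ) (ω : Sample G) :
    Tendsto (fun t : ℝ => numOpinions (opinionProcess ε t ω)) atTop
      (𝓝 (limitNumOpinions G ε ω)) := by
  apply tendsto_nhds_limUnder
  by_cases H : ∀ t, {k : ℕ | updateTime ω (k + 1) ≤ t}.Finite
  · refine ⟨_, tendsto_atTop_ciInf (fun s t hst => ?_) (OrderBot.bddBelow _)⟩
    exact antitone_numOpinions_configAfter ε ω
      (Set.ncard_le_ncard (fun k hk => le_trans hk hst) (H t))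
  · push Not at H
    obtain ⟨t₀, h₀⟩ := H
    refine ⟨numOpinions ω.1, tendsto_const_nhds.congr' ?_⟩
    filter_upwards [eventually_ge_atTop t₀] with t ht
    have hinf : {k : ℕ | updateTime ω (k + 1) ≤ t}.Infinite :=
      Set.Infinite.mono (fun k hk => le_trans hk ht) h₀
    simp [opinionProcess, numUpdates, hinf.ncard, configAfter]

end

end OpinionDynamics

/-!
Give an interface, that is, an edge whose end points hold different opinions, a weight that grows
linearly from `-1` to `1` as the distance of the two opinions grows from `0` to `4ε`. When a vertex
of degree at most two adopts the opinion of a neighbour, an interface shorter than `ε`, hence of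
weight less than `-1/2`, disappears, whereas the other interface at that vertex changes its length
by less than `ε` and its weight by less than `1/2`: the total weight does not decrease. On the path,
each opinion is held by consecutive vertices at all times, so that the number of opinions is one
more than the number of interfaces and hence exceeds the total weight. The initial weight is at
least `N - 1 - 2K`, where `K` is the number of edges along which the initial opinions are closer
than `4ε`. Revealing the initial opinions one at a time, each new one falls that close to the
previous one with probability at most `8ε`, and the exponential Markov inequality for `K` gives the
bound.
-/

namespace OpinionDynamics

section InterfaceWeight

/-- The weight of an edge whose end points hold opinions at distance `ℓ`, the summand of
`totalWeight`: it grows linearly from `-1` to `1` for lengths between `0` and `2 * s`, and edges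
between equal opinions do not count. -/
noncomputable def interfaceWeight (s ℓ : ℝ) : ℝ :=
  if ℓ = 0 then 0 else min 1 (ℓ / s - 1)

variable {s ℓ : ℝ}

lemma interfaceWeight_zero (s : ℝ) : interfaceWeight s 0 = 0 := if_pos rfl

lemma interfaceWeight_of_ne_zero (s : ℝ) (hℓ : ℓ ≠ 0) :
    interfaceWeight s ℓ = min 1 (ℓ / s - 1) := if_neg hℓ

lemma interfaceWeight_le_one (s ℓ : ℝ) : interfaceWeight s ℓ ≤ 1 := by
  unfold interfaceWeight
  split_ifs
  exacts [zero_le_one, min_le_left _ _]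

lemma interfaceWeight_nonpos (hs : 0 ≤ s) (hℓ : ℓ ≤ s) : interfaceWeight s ℓ ≤ 0 := by
  unfold interfaceWeight
  split_ifs
  · exact le_rfl
  · exact (min_le_right _ _).trans (sub_nonpos.2 (div_le_one_of_le₀ hℓ hs))

lemma one_sub_two_le_interfaceWeight (hs : 0 < s) (hℓ : 0 < ℓ) :
    1 - 2 * (if ℓ < 2 * s then 1 else 0) ≤ interfaceWeight s ℓ := by
  rw [interfaceWeight_of_ne_zero s hℓ.ne']
  split_ifs with h
  · have : 0 ≤ ℓ / s := by positivity
    exact le_min (by norm_num) (by linarith)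
  · have : 2 ≤ ℓ / s := by rwa [le_div_iff₀ hs, ← not_lt]
    exact le_min (by norm_num) (by linarith)

lemma interfaceWeight_dist_add_le {X : Type*} [PseudoMetricSpace X] {x y : X}
    (h : 2 * dist x y ≤ s) (z : X) :
    interfaceWeight s (dist x y) + interfaceWeight s (dist y z) ≤
      interfaceWeight s (dist x z) := by
  have hxy0 : 0 ≤ dist x y := dist_nonneg
  have hyz_le : dist y z ≤ dist x y + dist x z := dist_triangle_left y z x
  have hxz_le : dist x z ≤ dist x y + dist y z := dist_triangle x y z
  rcases eq_or_ne (dist x y) 0 with hxy | hxy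
  · have : dist y z = dist x z := by linarith
    rw [hxy, interfaceWeight_zero, zero_add, this]
  have hs : 0 < s := (mul_pos two_pos (hxy0.lt_of_ne' hxy)).trans_le h
  rcases eq_or_ne (dist y z) 0 with hyz | hyz
  · have : dist x y = dist x z := by linarith [dist_triangle_right x y z]
    rw [hyz, interfaceWeight_zero, add_zero, this]
  have hw := interfaceWeight_nonpos hs.le (by linarith : dist x y ≤ s)
  rcases eq_or_ne (dist x z) 0 with hxz | hxz
  · have : dist y z = dist x y := by linarith [dist_triangle_right x y z]
    rw [hxz, interfaceWeight_zero, this]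
    linarith
  have hhalf : dist x y / s ≤ 1 / 2 := by rw [div_le_iff₀ hs]; linarith
  have hdiv : dist y z / s ≤ dist x y / s + dist x z / s := by rw [← add_div]; gcongr
  rw [interfaceWeight_of_ne_zero s hxz]
  refine le_min (by linarith [interfaceWeight_le_one s (dist y z)]) ?_
  rw [interfaceWeight_of_ne_zero s hxy, interfaceWeight_of_ne_zero s hyz]
  linarith [min_le_right 1 (dist x y / s - 1), min_le_right 1 (dist y z / s - 1)]

end InterfaceWeight

section TotalWeight

variable {V X : Type*} [Fintype V] [DecidableEq V] [PseudoMetricSpace X]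
  (G : SimpleGraph V) [DecidableRel G.Adj]

/-- The sum of the interface weights over all edges, a lower bound for the number of opinions that
the dynamics with threshold `s / 2` never decreases on the path. -/
noncomputable def totalWeight (s : ℝ) (η : V → X) : ℝ :=
  ∑ e ∈ G.edgeFinset, Sym2.lift
    ⟨fun u v => interfaceWeight s (dist (η u) (η v)), fun _ _ => by simp only [dist_comm]⟩ e

lemma sum_edgeFinset_eq_add_sum_neighborFinset {M : Type*} [AddCommMonoid M] (f : Sym2 V → M)
    (y : V) : ∑ e ∈ G.edgeFinset, f e =
      ∑ e ∈ G.edgeFinset with y ∉ e, f e + ∑ z ∈ G.neighborFinset y, f s(y, z) := by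
  rw [← Finset.sum_filter_not_add_sum_filter G.edgeFinset (y ∈ ·)]
  congr 1
  refine (Finset.sum_bij (fun z _ => s(y, z)) ?_ ?_ ?_ fun _ _ => rfl).symm
  · simp
  · intro z _ z' _ h
    exact Sym2.congr_right.1 h
  · intro e he
    obtain ⟨he, z, rfl⟩ := Finset.mem_filter.1 he
    exact ⟨z, by simpa using he, rfl⟩

variable {G}

lemma totalWeight_le_update {s : ℝ} {η : V → X} {x y : V} (hxy : G.Adj y x)
    (hdeg : G.degree y ≤ 2) (hs : 2 * dist (η x) (η y) ≤ s) :
    totalWeight G s η ≤ totalWeight G s (Function.update η y (η x)) := by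
  have hs0 : 0 ≤ s := le_trans (by positivity) hs
  have hself := interfaceWeight_nonpos hs0 (by linarith [dist_nonneg (x := η x) (y := η y)] :
    dist (η x) (η y) ≤ s)
  unfold totalWeight
  simp only [sum_edgeFinset_eq_add_sum_neighborFinset G _ y, Sym2.lift_mk, Function.update_self]
  refine add_le_add (Finset.sum_congr rfl fun e he => ?_).le ?_
  · have hy : y ∉ e := (Finset.mem_filter.1 he).2
    induction e with | _ u v
    rw [Sym2.mem_iff, not_or] at hy
    simp only [Sym2.lift_mk, Function.update_of_ne (Ne.symm hy.1),
      Function.update_of_ne (Ne.symm hy.2)]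
  have hmem : x ∈ G.neighborFinset y := by simpa using hxy
  have hcard : ((G.neighborFinset y).erase x).card ≤ 1 := by
    rw [Finset.card_erase_of_mem hmem, G.card_neighborFinset_eq_degree]
    omega
  rw [← Finset.add_sum_erase _ _ hmem, ← Finset.add_sum_erase _ _ hmem,
    Function.update_of_ne hxy.ne', dist_self, interfaceWeight_zero, zero_add, dist_comm (η y)]
  rcases Nat.le_one_iff_eq_zero_or_eq_one.1 hcard with hcard | hcard
  · rw [Finset.card_eq_zero.1 hcard]
    simpa using hself
  · obtain ⟨z, hz⟩ := Finset.card_eq_one.1 hcard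
    have hzy : z ≠ y := by
      have : z ∈ (G.neighborFinset y).erase x := hz ▸ Finset.mem_singleton_self z
      exact (G.ne_of_adj (by simpa using Finset.mem_of_mem_erase this)).symm
    rw [hz, Finset.sum_singleton, Finset.sum_singleton, Function.update_of_ne hzy]
    exact interfaceWeight_dist_add_le hs (η z)

lemma totalWeight_le_interact {ε : ℝ} (η : Config V) (d : G.Dart)
    (hdeg : G.degree d.snd ≤ 2) :
    totalWeight G (2 * ε) η ≤ totalWeight G (2 * ε) (interact ε η d) := by
  unfold interact
  split_ifs with h
  · refine totalWeight_le_update d.adj.symm hdeg ?_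
    rw [dist_comm, Subtype.dist_eq, Real.dist_eq]
    linarith
  · exact le_rfl

end TotalWeight

section PathGraph

variable {n : ℕ}

instance decidableRelPathGraphAdj : DecidableRel (SimpleGraph.pathGraph n).Adj :=
  fun _ _ => decidable_of_iff' _ SimpleGraph.pathGraph_adj

lemma degree_pathGraph_le_two (v : Fin n) : (SimpleGraph.pathGraph n).degree v ≤ 2 := by
  have hsub : ((SimpleGraph.pathGraph n).neighborFinset v).map Fin.valEmbedding ⊆
      {(v : ℕ) - 1, (v : ℕ) + 1} := by
    intro k hk
    simp only [Finset.mem_map, SimpleGraph.mem_neighborFinset, SimpleGraph.pathGraph_adj,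
      Fin.valEmbedding_apply, Finset.mem_insert, Finset.mem_singleton] at hk ⊢
    omega
  rw [← SimpleGraph.card_neighborFinset_eq_degree, ← Finset.card_map Fin.valEmbedding]
  exact (Finset.card_le_card hsub).trans Finset.card_le_two

lemma sum_edgeFinset_pathGraph {M : Type*} [AddCommMonoid M] (f : Sym2 (Fin (n + 1)) → M) :
    ∑ e ∈ (SimpleGraph.pathGraph (n + 1)).edgeFinset, f e =
      ∑ i : Fin n, f s(i.castSucc, i.succ) := by
  refine (Finset.sum_bij (fun i _ => s(i.castSucc, i.succ)) ?_ ?_ ?_ fun _ _ => rfl).symm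
  · simp [SimpleGraph.pathGraph_adj]
  · intro i _ j _ h
    simp only [Sym2.eq_iff, Fin.ext_iff, Fin.val_castSucc, Fin.val_succ] at h
    omega
  · intro e he
    induction e with | _ u v
    simp only [SimpleGraph.mem_edgeFinset, SimpleGraph.mem_edgeSet, SimpleGraph.pathGraph_adj] at he
    rcases he with h | h
    · exact ⟨⟨u, by omega⟩, Finset.mem_univ _, Sym2.eq_iff.2 (.inl ⟨rfl, Fin.ext h⟩)⟩
    · exact ⟨⟨v, by omega⟩, Finset.mem_univ _, Sym2.eq_iff.2 (.inr ⟨rfl, Fin.ext h⟩)⟩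

lemma totalWeight_pathGraph {X : Type*} [PseudoMetricSpace X] (s : ℝ) (η : Fin (n + 1) → X) :
    totalWeight (SimpleGraph.pathGraph (n + 1)) s η =
      ∑ i : Fin n, interfaceWeight s (dist (η i.castSucc) (η i.succ)) :=
  sum_edgeFinset_pathGraph _

end PathGraph

section Intervals

variable {n : ℕ} {ι κ X : Type*}

/-- Each opinion is held by an interval of vertices (possibly empty), which makes distinct
interfaces of the path separate distinct opinions. -/
def HasIntervalLevels [Preorder ι] (η : ι → X) : Prop :=
  ∀ x, (η ⁻¹' {x}).OrdConnected

lemma HasIntervalLevels.of_injective [PartialOrder ι] {η : ι → X} (h : Function.Injective η) :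
    HasIntervalLevels η :=
  fun _ => (Set.subsingleton_singleton.preimage h).induction_on Set.ordConnected_empty
    fun _ => Set.ordConnected_singleton

lemma HasIntervalLevels.comp_monotone [Preorder ι] [Preorder κ] {η : ι → X}
    (h : HasIntervalLevels η) {σ : κ → ι} (hσ : Monotone σ) : HasIntervalLevels (η ∘ σ) :=
  fun x => (h x).preimage_mono hσ

lemma HasIntervalLevels.eq_of_le_of_le [Preorder ι] {η : ι → X} (h : HasIntervalLevels η)
    {i j k : ι} (hik : η i = η k) (hij : i ≤ j) (hjk : j ≤ k) : η j = η k :=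
  (h (η k)).out hik rfl ⟨hij, hjk⟩

lemma monotone_update_id_of_adj {u v : Fin n} (h : (SimpleGraph.pathGraph n).Adj u v) :
    Monotone (Function.update id v u) := by
  intro a b hab
  rw [SimpleGraph.pathGraph_adj] at h
  simp only [Function.update_apply, id]
  split_ifs <;> omega

lemma HasIntervalLevels.interact {η : Config (Fin n)} (h : HasIntervalLevels η) (ε : ℝ)
    (d : (SimpleGraph.pathGraph n).Dart) : HasIntervalLevels (interact ε η d) := by
  unfold OpinionDynamics.interact
  split_ifs
  · simpa only [Function.comp_update, Function.comp_id] using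
      h.comp_monotone (monotone_update_id_of_adj d.adj)
  · exact h

lemma HasIntervalLevels.injOn_interfaces {η : Fin (n + 1) → X} (h : HasIntervalLevels η) :
    Set.InjOn (fun i : Fin n => η i.succ) {i | η i.castSucc ≠ η i.succ} := by
  have hlt : ∀ i j : Fin n, i < j → η i.succ = η j.succ → η j.castSucc = η j.succ :=
    fun i j hij heq => h.eq_of_le_of_le heq (Fin.succ_le_castSucc_iff.2 hij) Fin.castSucc_lt_succ.le
  intro i hi j hj heq
  rcases lt_trichotomy i j with hij | hij | hij
  · exact (hj (hlt i j hij heq)).elim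
  · exact hij
  · exact (hi (hlt j i hij heq.symm)).elim

lemma HasIntervalLevels.card_interfaces_lt [DecidableEq X] {η : Fin (n + 1) → X}
    (h : HasIntervalLevels η) :
    Finset.card {i : Fin n | η i.castSucc ≠ η i.succ} < (Set.range η).ncard := by
  set I : Finset (Fin n) := {i | η i.castSucc ≠ η i.succ}
  have hinj : Set.InjOn (fun i : Fin n => η i.succ) I := by
    simpa [I] using h.injOn_interfaces
  have hzero : η 0 ∉ I.image fun i => η i.succ := by
    intro hmem
    obtain ⟨i, hi, heq⟩ := Finset.mem_image.1 hmem
    exact (Finset.mem_filter.1 hi).2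
      (h.eq_of_le_of_le heq.symm (Fin.zero_le _) Fin.castSucc_lt_succ.le)
  calc I.card < (insert (η 0) (I.image fun i => η i.succ)).card := by
        rw [Finset.card_insert_of_notMem hzero, Finset.card_image_of_injOn hinj]
        exact Nat.lt_succ_self _
    _ ≤ (Set.range η).ncard := by
        rw [← Set.ncard_coe_finset]
        refine Set.ncard_le_ncard ?_ (Set.finite_range η)
        rw [Finset.coe_insert, Finset.coe_image, Set.insert_subset_iff]
        exact ⟨Set.mem_range_self 0, Set.image_subset_iff.2 fun i _ => Set.mem_range_self i.succ⟩

lemma HasIntervalLevels.totalWeight_add_one_le [PseudoMetricSpace X] {η : Fin (n + 1) → X}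
    (h : HasIntervalLevels η) (s : ℝ) :
    totalWeight (SimpleGraph.pathGraph (n + 1)) s η + 1 ≤ (Set.range η).ncard := by
  classical
  have hweight : totalWeight (SimpleGraph.pathGraph (n + 1)) s η ≤
      Finset.card {i : Fin n | η i.castSucc ≠ η i.succ} := by
    rw [totalWeight_pathGraph, Finset.natCast_card_filter]
    refine Finset.sum_le_sum fun i _ => ?_
    split_ifs with hi
    · exact interfaceWeight_le_one s _
    · rw [not_not.1 hi, dist_self, interfaceWeight_zero]
  have hcard : (Finset.card {i : Fin n | η i.castSucc ≠ η i.succ} : ℝ) + 1 ≤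
      (Set.range η).ncard := mod_cast h.card_interfaces_lt
  linarith

end Intervals

section Dynamics

variable {V : Type*} [DecidableEq V] {G : SimpleGraph V} {ε : ℝ} {ω : Sample G}

lemma configAfter_induction {P : Config V → Prop} (hinit : P ω.1)
    (hstep : ∀ η (d : G.Dart), P η → P (interact ε η d)) (k : ℕ) : P (configAfter ε ω k) := by
  induction k with
  | zero => exact hinit
  | succ k ih =>
    rw [configAfter]
    split_ifs
    exacts [hstep _ _ ih, ih]

lemma exists_configAfter_eq_limitNumOpinions [Finite V] (G : SimpleGraph V) (ε : ℝ)
    (ω : Sample G) : ∃ k, numOpinions (configAfter ε ω k) = limitNumOpinions G ε ω := by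
  have hlim := tendsto_numOpinions G ε ω
  rw [nhds_discrete, tendsto_pure] at hlim
  obtain ⟨t, ht⟩ := hlim.exists
  exact ⟨numUpdates ω t, ht⟩

end Dynamics

section InitialWeight

/-- The number of edges of the path along which the opinions are at distance less than `r`; for
`r = 2 * s` these are the edges of weight less than `1`. -/
noncomputable def closePairs {n : ℕ} {X : Type*} [Dist X] (r : ℝ) (η : Fin (n + 1) → X) : ℕ :=
  Finset.card {i : Fin n | dist (η i.castSucc) (η i.succ) < r}

lemma sub_two_mul_closePairs_le_totalWeight {n : ℕ} {X : Type*} [MetricSpace X] {s : ℝ}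
    (hs : 0 < s) {η : Fin (n + 1) → X} (hη : ∀ i : Fin n, η i.castSucc ≠ η i.succ) :
    (n : ℝ) - 2 * closePairs (2 * s) η ≤ totalWeight (SimpleGraph.pathGraph (n + 1)) s η := by
  calc (n : ℝ) - 2 * closePairs (2 * s) η
      = ∑ i : Fin n, (1 - 2 * (if dist (η i.castSucc) (η i.succ) < 2 * s then 1 else 0)) := by
        rw [Finset.sum_sub_distrib, ← Finset.mul_sum, closePairs, Finset.natCast_card_filter]
        simp
    _ ≤ ∑ i : Fin n, interfaceWeight s (dist (η i.castSucc) (η i.succ)) :=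
        Finset.sum_le_sum fun i _ => one_sub_two_le_interfaceWeight hs (dist_pos.2 (hη i))
    _ = totalWeight (SimpleGraph.pathGraph (n + 1)) s η := (totalWeight_pathGraph s η).symm

lemma sub_two_mul_closePairs_le_limitNumOpinions {n : ℕ} {ε : ℝ} (hε : 0 < ε)
    {ω : Sample (SimpleGraph.pathGraph (n + 1))} (hω : Function.Injective ω.1) :
    ((n + 1 : ℕ) : ℝ) - 2 * closePairs (4 * ε) ω.1 ≤
      limitNumOpinions (SimpleGraph.pathGraph (n + 1)) ε ω := by
  obtain ⟨k, hk⟩ := exists_configAfter_eq_limitNumOpinions (SimpleGraph.pathGraph (n + 1)) ε ω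
  obtain ⟨hlevels, hweight⟩ := configAfter_induction (ε := ε) (ω := ω)
    (P := fun η => HasIntervalLevels η ∧ totalWeight _ (2 * ε) ω.1 ≤ totalWeight _ (2 * ε) η)
    ⟨.of_injective hω, le_rfl⟩ (fun η d h => ⟨h.1.interact ε d,
      h.2.trans (totalWeight_le_interact η d (degree_pathGraph_le_two _))⟩) k
  have hinit := sub_two_mul_closePairs_le_totalWeight (mul_pos two_pos hε)
    fun i => hω.ne (Fin.castSucc_lt_succ (i := i)).ne
  have hfinal := hlevels.totalWeight_add_one_le (2 * ε)
  rw [← mul_assoc, show (2 * 2 : ℝ) = 4 by norm_num] at hinit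
  rw [← hk]
  push_cast [numOpinions]
  linarith

end InitialWeight

section Product

variable {X : Type*} [MeasurableSpace X] {μ : Measure X}

lemma lintegral_pi_eq_lintegral_cons [SigmaFinite μ] {n : ℕ} {F : (Fin (n + 1) → X) → ENNReal}
    (hF : Measurable F) :
    ∫⁻ η, F η ∂(Measure.pi fun _ => μ) =
      ∫⁻ η, ∫⁻ x, F (Fin.cons x η) ∂μ ∂(Measure.pi fun _ : Fin n => μ) := by
  have hcons := (measurePreserving_piFinSuccAbove (fun _ : Fin (n + 1) => μ) 0).symm
  rw [← hcons.lintegral_comp hF]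
  refine (lintegral_prod_symm' _ (hF.comp hcons.measurable)).trans ?_
  simp only [Function.comp_apply, MeasurableEquiv.piFinSuccAbove_symm_apply, Fin.insertNthEquiv,
    Equiv.coe_fn_mk, Fin.insertNth_zero']

lemma lintegral_prod_consecutive_le [IsProbabilityMeasure μ] {f : X × X → ENNReal}
    (hf : Measurable f) {C : ENNReal} (hC : ∀ y, ∫⁻ x, f (x, y) ∂μ ≤ C) (n : ℕ) :
    ∫⁻ η, ∏ i : Fin n, f (η i.castSucc, η i.succ) ∂(Measure.pi fun _ : Fin (n + 1) => μ) ≤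
      C ^ n := by
  induction n with
  | zero => simp
  | succ n ih =>
    calc ∫⁻ η, ∏ i : Fin (n + 1), f (η i.castSucc, η i.succ) ∂(Measure.pi fun _ => μ)
        = ∫⁻ η, ∫⁻ x, f (x, η 0) * ∏ i : Fin n, f (η i.castSucc, η i.succ) ∂μ
            ∂(Measure.pi fun _ : Fin (n + 1) => μ) := by
          rw [lintegral_pi_eq_lintegral_cons (by fun_prop)]
          simp only [Fin.prod_univ_succ, Fin.castSucc_zero, Fin.cons_zero, Fin.cons_succ,
            ← Fin.succ_castSucc]
      _ ≤ ∫⁻ η, C * ∏ i : Fin n, f (η i.castSucc, η i.succ)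
            ∂(Measure.pi fun _ : Fin (n + 1) => μ) := by
          gcongr with η
          rw [lintegral_mul_const _ (by fun_prop)]
          gcongr
          exact hC _
      _ ≤ C ^ (n + 1) := by
          rw [lintegral_const_mul _ (by fun_prop), pow_succ']
          gcongr

lemma ae_injective_pi {ι : Type*} [Fintype ι] [MeasurableEq X] [IsProbabilityMeasure μ]
    [NullSingletonClass μ] : ∀ᵐ η ∂(Measure.pi fun _ : ι => μ), Function.Injective η := by
  have hdiag : ∀ᵐ q ∂(μ.prod μ), q.1 ≠ q.2 := by
    refine (Measure.ae_prod_iff_ae_ae measurableSet_diagonal.compl).2 (.of_forall fun x => ?_)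
    simp [ae_iff]
  have hne : ∀ i j : ι, i ≠ j → ∀ᵐ η ∂(Measure.pi fun _ : ι => μ), η i ≠ η j := by
    intro i j hij
    have hind : IndepFun (fun η : ι → X => η i) (fun η => η j) (Measure.pi fun _ => μ) :=
      (iIndepFun_pi (X := fun _ => id) fun _ => aemeasurable_id).indepFun hij
    have hmap : (Measure.pi fun _ : ι => μ).map (fun η => (η i, η j)) = μ.prod μ := by
      rw [(indepFun_iff_map_prod_eq_prod_map_map (measurable_pi_apply i).aemeasurable
          (measurable_pi_apply j).aemeasurable).1 hind,
        (measurePreserving_eval _ i).map_eq, (measurePreserving_eval _ j).map_eq]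
    rw [← hmap] at hdiag
    exact ae_of_ae_map (p := fun q : X × X => q.1 ≠ q.2) (by fun_prop) hdiag
  have hall : ∀ᵐ η ∂(Measure.pi fun _ : ι => μ), ∀ i j, i ≠ j → η i ≠ η j := by
    simpa only [ae_all_iff] using hne
  filter_upwards [hall] with η hη i j hij
  exact not_imp_not.1 (hη i j) hij

end Product

section ClosePairs

variable {X : Type*} [PseudoMetricSpace X] [MeasurableSpace X] [OpensMeasurableSpace X]
  {μ : Measure X} [IsProbabilityMeasure μ] {r p t : ℝ}

lemma lintegral_exp_indicator_ball_le (ht : 0 ≤ t) {y : X}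
    (hp : μ.real (Metric.ball y r) ≤ p) :
    ∫⁻ x, ENNReal.ofReal (if dist x y < r then Real.exp t else 1) ∂μ ≤
      ENNReal.ofReal (1 + (Real.exp t - 1) * p) := by
  have hsplit : ∀ x, (if dist x y < r then Real.exp t else 1) =
      1 + (Metric.ball y r).indicator (fun _ => Real.exp t - 1) x := fun x => by
    by_cases h : dist x y < r <;> simp [h]
  have hind : Integrable (fun x => (Metric.ball y r).indicator (fun _ => Real.exp t - 1) x) μ :=
    (integrable_const _).indicator measurableSet_ball
  have hintegrable :
      Integrable (fun x => 1 + (Metric.ball y r).indicator (fun _ => Real.exp t - 1) x) μ :=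
    (integrable_const _).add hind
  have hnonneg : ∀ x, 0 ≤ 1 + (Metric.ball y r).indicator (fun _ => Real.exp t - 1) x :=
    fun x => by rw [← hsplit]; positivity
  simp_rw [hsplit]
  rw [← ofReal_integral_eq_lintegral_ofReal hintegrable (.of_forall hnonneg),
    integral_add (integrable_const _) hind, integral_indicator_const _ measurableSet_ball,
    integral_const, probReal_univ, one_smul, smul_eq_mul, mul_comm]
  have := sub_nonneg.2 (Real.one_le_exp ht)
  gcongr

variable [SecondCountableTopology X]

lemma measurable_closePairs {n : ℕ} (r : ℝ) :
    Measurable (closePairs r : (Fin (n + 1) → X) → ℕ) := by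
  unfold closePairs
  simp only [Finset.card_filter]
  refine Finset.measurable_sum _ fun i _ => Measurable.ite ?_ measurable_const measurable_const
  exact measurableSet_lt (by fun_prop) measurable_const

lemma mgf_closePairs_le (ht : 0 ≤ t) (hp : ∀ y, μ.real (Metric.ball y r) ≤ p) (n : ℕ) :
    mgf (fun η => (closePairs r η : ℝ)) (Measure.pi fun _ : Fin (n + 1) => μ) t ≤
      (1 + (Real.exp t - 1) * p) ^ n := by
  have hp0 : 0 ≤ p := measureReal_nonneg.trans (hp μ.nonempty_of_neZero.some)
  have hbase : 0 ≤ 1 + (Real.exp t - 1) * p := by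
    have := sub_nonneg.2 (Real.one_le_exp ht)
    positivity
  have hmeas : Measurable fun q : X × X =>
      ENNReal.ofReal (if dist q.1 q.2 < r then Real.exp t else 1) :=
    (Measurable.ite (measurableSet_lt (by fun_prop) measurable_const) measurable_const
      measurable_const).ennreal_ofReal
  have hprod : ∀ η : Fin (n + 1) → X, ENNReal.ofReal (Real.exp (t * closePairs r η)) =
      ∏ i : Fin n,
        ENNReal.ofReal (if dist (η i.castSucc) (η i.succ) < r then Real.exp t else 1) := fun η => by
    rw [← ENNReal.ofReal_prod_of_nonneg fun i _ => by positivity, Finset.prod_ite,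
      Finset.prod_const, Finset.prod_const_one, mul_one, mul_comm, Real.exp_nat_mul, closePairs]
  have hexp : Measurable fun η : Fin (n + 1) → X => Real.exp (t * closePairs r η) :=
    (measurable_of_countable fun k : ℕ => Real.exp (t * k)).comp (measurable_closePairs r)
  rw [mgf, integral_eq_lintegral_of_nonneg_ae (.of_forall fun _ => by positivity)
    hexp.aestronglyMeasurable]
  refine ENNReal.toReal_le_of_le_ofReal (by positivity) ?_
  simp_rw [hprod]
  rw [ENNReal.ofReal_pow hbase]
  exact lintegral_prod_consecutive_le hmeas (fun y => lintegral_exp_indicator_ball_le ht (hp y)) n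

lemma measureReal_le_closePairs_le (hp : ∀ y, μ.real (Metric.ball y r) ≤ p) (a : ℝ) (n : ℕ) :
    (Measure.pi fun _ : Fin (n + 1) => μ).real {η | a ≤ closePairs r η} ≤
      Real.exp (2 * p * n - a) := by
  have hp0 : 0 ≤ p := measureReal_nonneg.trans (hp μ.nonempty_of_neZero.some)
  have hintegrable : Integrable (fun η => Real.exp (1 * (closePairs r η : ℝ)))
      (Measure.pi fun _ : Fin (n + 1) => μ) := by
    refine integrable_exp_mul_of_mem_Icc (a := 0) (b := n)
      ((measurable_of_countable _).comp (measurable_closePairs r)).aemeasurable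
      (.of_forall fun η => ⟨Nat.cast_nonneg _, ?_⟩)
    exact_mod_cast (Finset.card_filter_le _ _).trans_eq (Finset.card_fin n)
  have hbase : 1 + (Real.exp 1 - 1) * p ≤ Real.exp (2 * p) := by
    nlinarith [Real.add_one_le_exp (2 * p), Real.exp_one_lt_three]
  calc (Measure.pi fun _ : Fin (n + 1) => μ).real {η | a ≤ closePairs r η}
      ≤ Real.exp (-1 * a) * mgf (fun η => (closePairs r η : ℝ)) (Measure.pi fun _ => μ) 1 :=
        measure_ge_le_exp_mul_mgf a zero_le_one hintegrable
    _ ≤ Real.exp (-1 * a) * (1 + (Real.exp 1 - 1) * p) ^ n := by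
        gcongr
        exact mgf_closePairs_le zero_le_one hp n
    _ ≤ Real.exp (-1 * a) * Real.exp (2 * p) ^ n := by
        have := sub_nonneg.2 (Real.one_le_exp zero_le_one)
        gcongr
    _ = Real.exp (2 * p * n - a) := by
        rw [← Real.exp_nat_mul, ← Real.exp_add]
        ring_nf

end ClosePairs

lemma measureReal_ball_unitInterval_le {r : ℝ} (hr : 0 ≤ r) (y : unitInterval) :
    (volume : Measure unitInterval).real (Metric.ball y r) ≤ 2 * r := by
  refine ENNReal.toReal_le_of_le_ofReal (by positivity) ?_
  calc volume (Metric.ball y r)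
      = volume (Subtype.val '' Metric.ball y r) :=
        (volume_image_subtype_coe measurableSet_Icc _).symm
    _ ≤ volume (Metric.ball (y : ℝ) r) := measure_mono (Set.image_subset_iff.2 fun _ hx => hx)
    _ = ENNReal.ofReal (2 * r) := Real.volume_ball _ _

lemma law_real_limitNumOpinions_lt_le {ε : ℝ} (hε : 0 < ε) (a : ℝ) (n : ℕ) :
    (law (SimpleGraph.pathGraph (n + 1))).real
        {ω | (limitNumOpinions (SimpleGraph.pathGraph (n + 1)) ε ω : ℝ) <
          ((n + 1 : ℕ) : ℝ) - 2 * a} ≤ Real.exp (16 * ε * n - a) := by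
  set close : Set (Config (Fin (n + 1))) := {η | a ≤ closePairs (4 * ε) η}
  have hclose : MeasurableSet close := measurableSet_le measurable_const
    ((measurable_of_countable _).comp (measurable_closePairs _))
  have hinj : ∀ᵐ ω ∂law (SimpleGraph.pathGraph (n + 1)), Function.Injective ω.1 :=
    Measure.quasiMeasurePreserving_fst.ae ae_injective_pi
  calc (law (SimpleGraph.pathGraph (n + 1))).real _
      ≤ (law (SimpleGraph.pathGraph (n + 1))).real (Prod.fst ⁻¹' close) := by
        refine ENNReal.toReal_mono (measure_ne_top _ _) (measure_mono_ae ?_)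
        filter_upwards [hinj] with ω hω (hlt : (limitNumOpinions _ ε ω : ℝ) < _)
        have hdet := sub_two_mul_closePairs_le_limitNumOpinions hε hω
        change a ≤ closePairs (4 * ε) ω.1
        linarith
    _ = (Measure.pi fun _ : Fin (n + 1) => (volume : Measure unitInterval)).real close :=
        measurePreserving_fst.measureReal_preimage hclose.nullMeasurableSet
    _ ≤ Real.exp (2 * (2 * (4 * ε)) * n - a) :=
        measureReal_le_closePairs_le
          (measureReal_ball_unitInterval_le (mul_pos four_pos hε).le) a n
    _ = Real.exp (16 * ε * n - a) := by ring_nf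

end OpinionDynamics

theorem theorem4 :
    ∃ c₁ c₂ : ℝ, 0 < c₁ ∧ 0 < c₂ ∧
      ∀ (N : ℕ) (ε : ℝ), 1 ≤ N → 0 ≤ ε → ε ≤ 1 →
        (OpinionDynamics.law (SimpleGraph.pathGraph N)).real
          {ω | (OpinionDynamics.limitNumOpinions (SimpleGraph.pathGraph N) ε ω : ℝ)
            < (1 - c₁ * ε) * (N : ℝ)}
          ≤ Real.exp (-(c₂ * ε * (N : ℝ))) := by
  refine ⟨34, 1, by norm_num, one_pos, fun N ε hN hε0 _ => ?_⟩
  rcases hε0.eq_or_lt with rfl | hε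
  · simp
  obtain ⟨n, rfl⟩ := Nat.exists_eq_add_of_le' hN
  have hthreshold : (1 - 34 * ε) * ((n + 1 : ℕ) : ℝ) =
      ((n + 1 : ℕ) : ℝ) - 2 * (17 * ε * (n + 1 : ℕ)) := by ring
  rw [hthreshold]
  refine (OpinionDynamics.law_real_limitNumOpinions_lt_le hε _ n).trans (Real.exp_le_exp.2 ?_)
  push_cast
  linarith
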